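/- For a group $G$ let $S(G)$ be the group of permutations of the set $G$ under left-to-right composition (maps act on the right), let $\rho : G \to S(G)$, $g \mapsto (h \mapsto hg)$, be the right regular representation, and put $$\mathrm{Hol}(G) = N_{S(G)}(\rho(G)),\qquad \mathrm{NHol}(G) = N_{S(G)}(\mathrm{Hol}(G)),\qquad T(G) = \mathrm{NHol}(G)/\mathrm{Hol}(G).$$ Let $p > 2$ be a prime and let $$G_p = \langle x, y : x^{p^2},\ y^{p^2},\ [x,y] = x^p\rangle,\qquad [x,y] = x^{-1}y^{-1}xy.$$ For $s, t \in \mathbf{F}_p$ let $\gamma_{s,t} : G_p \to \mathrm{Aut}(G_p)$ be the map satisfying $\gamma(gh) = \gamma(h)\gamma(g)$ and $\gamma(g^\beta) = \beta^{-1}\gamma(g)\beta$ for all $g, h \in G_p$, $\beta \in \mathrm{Aut}(G_p)$, and $$\gamma_{s,t}(x) : x \mapsto x,\ y \mapsto x^{ps}y;\qquad \gamma_{s,t}(y) : x \mapsto x^{1+pt},\ y \mapsto y^{1+p(s+t)}.$$ For an integer $d$ coprime to $p$, with inverse $d'$ modulo $p$, and $s \in \mathbf{F}_p$, let $t = d'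 + s - 1$, let $g \circ h = g^{\gamma_{s,t}(h)}h$, and let $\theta_{d,s} : G_p \to (G_p, \circ)$ be the isomorphism such that $x \mapsto x$ and $y \mapsto y^d$. Then $G_p$ has order $p^4$. For all $d$ coprime to $p$ and all $s \in \mathbf{F}_p$ the map $\theta_{d,s}$ exists, is unique and lies in $\mathrm{NHol}(G_p)$, and its class in $T(G_p)$ depends only on $s$ and on $d$ modulo $p$. Writing $\equiv$ for equality of classes in $T(G_p)$ and $e'$ for the inverse of $e$ modulo $p$, $$\theta_{d,s}\,\theta_{e,u} \equiv \theta_{de,\ se'+u}\qquad (d, e \in \mathbf{F}_p^*,\ s, u \in \mathbf{F}_p).$$ Every element of $T(G_p)$ is the class of $\theta_{d,s}$ for exactly one pair $(d,s) \in \mathbf{F}_p^* \times \mathbf{F}_p$. Hence $T(G_p)$ has order $p(p-1)$ and is isomorphic to $\mathrm{AGL}(1,p)$, that is, to the holomorph of a group of order $p$. In particular $T(G_p)$ is non-abelian and is not a $2$-group, and for $p > 3$ it is not generated by its involutions. -/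

import Mathlib

open MulOpposite

section MultipleHolomorph

variable (G : Type*) [Group G]

/-- The group `S(G)` of permutations of the set `G` under left-to-right composition:
`op σ * op τ = op (τ * σ)` is "first `σ`, then `τ`". -/
abbrev SymLR : Type _ := (Equiv.Perm G)ᵐᵒᵖ

/-- The right regular representation `ρ : G → S(G)`, `g ↦ (h ↦ h * g)`. -/
def rightReg : G →* SymLR G where
  toFun g := op (Equiv.mulRight g)
  map_one' := by
    rw [Equiv.mulRight_one]; rfl
  map_mul' g h := by
    rw [← op_mul]
    congr 1
    ext k
    simp [mul_assoc]

/-- The holomorph `Hol(G) = N_{S(G)}(ρ(G))`. -/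
def Hol : Subgroup (SymLR G) := Subgroup.normalizer ((rightReg G).range : Set (SymLR G))

/-- The multiple holomorph `NHol(G) = N_{S(G)}(Hol(G))`. -/
def NHol : Subgroup (SymLR G) := Subgroup.normalizer (Hol G : Set (SymLR G))

instance Hol.normal_subgroupOf_NHol : ((Hol G).subgroupOf (NHol G)).Normal :=
  Subgroup.normal_in_normalizer

/-- `T(G) = NHol(G) / Hol(G)`. -/
abbrev T : Type _ := NHol G ⧸ (Hol G).subgroupOf (NHol G)

end MultipleHolomorph

/-- The relators `x^{p²}`, `y^{p²}`, `[x, y] x^{-p}`, where `[x, y] = x⁻¹ y⁻¹ x y`. -/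
def Gp.rels (p : ℕ) : Set (FreeGroup (Fin 2)) :=
  let x := FreeGroup.of (0 : Fin 2)
  let y := FreeGroup.of (1 : Fin 2)
  {x ^ p ^ 2, y ^ p ^ 2, x⁻¹ * y⁻¹ * x * y * (x ^ p)⁻¹}

/-- `G_p = ⟨x, y : x^{p²}, y^{p²}, [x, y] = x^p⟩`. -/
abbrev Gp (p : ℕ) : Type := PresentedGroup (Gp.rels p)

/-- The generator `x` of `G_p`. -/
def Gp.x (p : ℕ) : Gp p := PresentedGroup.of 0

/-- The generator `y` of `G_p`. -/
def Gp.y (p : ℕ) : Gp p := PresentedGroup.of 1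

/-- `γ` is the map `γ_{s,t} : G_p → Aut(G_p)`. Under left-to-right composition the laws read
`γ(gh) = γ(h)γ(g)` and `γ(g^β) = γ(g)^β` for all `β ∈ Aut(G_p)`. Multiplication in `MulAut` is
right-to-left composition, so the first law says that `γ` is a homomorphism into `MulAut`.
The exponents `s, t ∈ F_p` are represented by natural numbers; since `x^{p²} = y^{p²} = 1`, the
choice of representatives does not matter. -/
structure IsGamma (p : ℕ) (s t : ZMod p) (γ : Gp p →* MulAut (Gp p)) : Prop where
  equivariant : ∀ (β : MulAut (Gp p)) (g : Gp p), γ (β g) = β * γ g * β⁻¹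
  x_x : γ (Gp.x p) (Gp.x p) = Gp.x p
  x_y : γ (Gp.x p) (Gp.y p) = Gp.x p ^ (p * s.val) * Gp.y p
  y_x : γ (Gp.y p) (Gp.x p) = Gp.x p ^ (1 + p * t.val)
  y_y : γ (Gp.y p) (Gp.y p) = Gp.y p ^ (1 + p * (s + t).val)

/-- The operation `g ∘ h = g^{γ(h)} h` attached to `γ`. -/
def circ {G : Type*} [Group G] (γ : G →* MulAut G) (g h : G) : G := γ h g * h

/-- `θ` is the isomorphism `θ_{d,s} : G_p → (G_p, ∘)` with `x ↦ x` and `y ↦ y^d`, where `∘` is the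
operation attached to `γ_{s,t}` for `t = d' + s - 1`, and `d'` is the inverse of `d` modulo `p`. -/
def IsTheta (p : ℕ) (d : ℤ) (s : ZMod p) (θ : Equiv.Perm (Gp p)) : Prop :=
  ∃ γ : Gp p →* MulAut (Gp p), IsGamma p s ((d : ZMod p)⁻¹ + s - 1) γ ∧
    (∀ g h : Gp p, θ (g * h) = circ γ (θ g) (θ h)) ∧
    θ (Gp.x p) = Gp.x p ∧ θ (Gp.y p) = Gp.y p ^ d

/-! ### Permutations normalizing the holomorph and equivariant maps `γ` -/

section Twist

variable {G : Type*} [Group G]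

/-! A permutation `θ` in `NHol G` fixing 1 turns the product into θ(gh) = γ(θh)(θg)·θh, where γ is a
homomorphism to `MulAut G` commuting with the action of Aut(G) (`exists_isTwist_of_op_mem_NHol`).
For finite G every such θ lies in `NHol G` (`IsTwist.op_mem_NHol`). Each class in T(G) has a
representative fixing 1, and two of these are equivalent iff they have the same γ
(`IsTwist.mk_eq_mk_iff`). So T(G) amounts to the set of equivariant γ for which (G, ∘) is isomorphic
to G.

In G_p every element is x^i y^j with i, j modulo p². All claims become polynomial identities over
Z/p², where p·p = 0 and p·z depends only on z modulo p. The automorphisms x ↦ x² and y ↦ xy,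
together with the relation xy = yx^(1+p), already force γ = γ_{s,t} (`exists_eq_gammaST`). The
products x ∘ y^d and y^d ∘ x differ by x^(pd(t-s+1)), while xy and yx differ by x^p. Hence t-s+1 = 0
makes ∘ commutative and is excluded; otherwise d is the inverse of t-s+1, and θ_{d,s} exists.

Modulo p, θ_{e,u} multiplies the exponent of y by e, so conjugating γ_{s,t} by it divides s and t by
e. This is the composition law (`IsTheta.mul_isTwist`), and it is that of affine maps of F_p. -/

theorem op_mem_Hol_iff (τ : Equiv.Perm G) :
    op τ ∈ Hol G ↔ ∀ h g : G, τ (h * g) = τ h * (τ 1)⁻¹ * τ g := by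
  constructor
  · intro hτ h g
    have hτ' := inv_mem hτ
    have h1 := (Subgroup.mem_normalizer_iff.mp hτ' (rightReg G g)).mp ⟨g, rfl⟩
    obtain ⟨k, hk⟩ := h1
    have h2 : ∀ a : G, τ (τ.symm a * g) = a * k := by
      intro a
      have := congrArg (fun f : SymLR G => (unop f) a) hk
      simpa [rightReg] using this.symm
    have h3 := h2 (τ h)
    have h4 := h2 (τ 1)
    rw [Equiv.symm_apply_apply] at h3 h4
    rw [one_mul] at h4
    rw [h3, h4]
    group
  · intro H
    have key : ∀ σ : Equiv.Perm G, (∀ h g : G, σ (h * g) = σ h * (σ 1)⁻¹ * σ g) →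
        ∀ f ∈ (rightReg G).range, op σ⁻¹ * f * (op σ⁻¹)⁻¹ ∈ (rightReg G).range := by
      rintro σ hσ _ ⟨g, rfl⟩
      refine ⟨(σ 1)⁻¹ * σ g, ?_⟩
      apply unop_injective
      ext a
      have := hσ (σ.symm a) g
      simp only [Equiv.apply_symm_apply] at this
      simp [rightReg, this, mul_assoc]
    -- Normalizing is an equivalence, so `key` is needed for `τ` and for its inverse. The identity
    -- passes to the inverse because it says that `τ` preserves the ternary operation `a * b⁻¹ * c`.
    have H' : ∀ h g : G, τ.symm (h * g) = τ.symm h * (τ.symm 1)⁻¹ * τ.symm g := by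
      intro h g
      apply τ.injective
      have e1 : ∀ a b c : G, τ (a * b⁻¹ * c) = τ a * (τ b)⁻¹ * τ c := by
        intro a b c
        have e2 := H (a * b⁻¹) b
        rw [inv_mul_cancel_right] at e2
        rw [H, e2]
        group
      rw [e1]
      simp
    refine Subgroup.mem_normalizer_iff.mpr fun f => ⟨fun hf => ?_, fun hf => ?_⟩
    · exact key τ.symm H' f hf
    · have := key τ H _ hf
      simpa [mul_assoc] using this

theorem op_mem_Hol_of_forall_exists (τ : Equiv.Perm G)
    (H : ∀ g : G, ∃ g' : G, ∀ h : G, τ (h * g) = τ h * g') : op τ ∈ Hol G := by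
  rw [op_mem_Hol_iff]
  intro h g
  obtain ⟨k, hk⟩ := H g
  have h1 := hk 1
  rw [one_mul] at h1
  rw [hk, h1]
  group

theorem op_mem_Hol_iff_of_map_one {τ : Equiv.Perm G} (h1 : τ 1 = 1) :
    op τ ∈ Hol G ↔ ∀ h g : G, τ (h * g) = τ h * τ g := by
  rw [op_mem_Hol_iff, h1]
  simp

theorem op_mulAut_mem_Hol (β : MulAut G) : op (β.toEquiv : Equiv.Perm G) ∈ Hol G :=
  (op_mem_Hol_iff_of_map_one (by simp)).mpr fun h g => by simp

theorem rightReg_mem_Hol (g : G) : rightReg G g ∈ Hol G := by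
  refine op_mem_Hol_of_forall_exists (Equiv.mulRight g) fun k => ⟨g⁻¹ * k * g, fun h => ?_⟩
  simp [mul_assoc]

/-- A permutation `θ` which is an isomorphism from `G` onto `(G, ∘)`, for the operation
`g ∘ h = γ(h)(g) h`. -/
def IsTwist (γ : G →* MulAut G) (θ : Equiv.Perm G) : Prop :=
  ∀ g h : G, θ (g * h) = circ γ (θ g) (θ h)

/-- `γ` commutes with the actions of the automorphism group. -/
def IsEquivariant (γ : G →* MulAut G) : Prop :=
  ∀ (β : MulAut G) (g : G), γ (β g) = β * γ g * β⁻¹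

variable {γ : G →* MulAut G}

theorem IsTwist.map_one {θ : Equiv.Perm G} (hθ : IsTwist γ θ) : θ 1 = 1 := by
  have h := hθ 1 1
  rw [mul_one, circ] at h
  have h2 : γ (θ 1) (θ 1) = 1 := by simpa using h.symm
  simpa using h2

theorem IsTwist.eq_of_isTwist {γ' : G →* MulAut G} {θ : Equiv.Perm G} (h : IsTwist γ θ)
    (h' : IsTwist γ' θ) : γ = γ' := by
  ext a b
  obtain ⟨g, rfl⟩ := θ.surjective b
  obtain ⟨k, rfl⟩ := θ.surjective a
  have := (h g k).symm.trans (h' g k)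
  simpa [circ] using this

/-- By equivariance γ(γ(b)k) = γ(b)γ(k)γ(b)⁻¹, and everything else cancels. -/
theorem IsEquivariant.map_circ_factor (hγ : IsEquivariant γ) (b k : G) :
    γ ((γ b k)⁻¹ * b * k) = γ b := by
  rw [map_mul, map_mul, map_inv, hγ]
  group

/-- Source of most constraints in the classification: automorphisms fixing `g` centralize `γ g`. -/
theorem IsEquivariant.comm_of_fixed (hγ : IsEquivariant γ) {β : MulAut (G)} {g : G}
    (h : β g = g) (k : G) : γ g (β k) = β (γ g k) := by
  have h1 := hγ β g
  rw [h, eq_mul_inv_iff_mul_eq] at h1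
  exact congrArg (fun f : MulAut (G) => f k) h1

theorem IsTwist.op_mem_NHol [Finite G] (hγ : IsEquivariant γ) {θ : Equiv.Perm G}
    (hθ : IsTwist γ θ) : op θ ∈ NHol G := by
  have key : ∀ f ∈ Hol G, op θ * f * (op θ)⁻¹ ∈ Hol G := by
    intro f hf
    obtain ⟨σ, rfl⟩ := op_surjective f
    rw [op_mem_Hol_iff] at hf
    change op (θ.symm * (σ * θ)) ∈ Hol G
    -- An element of the holomorph is an automorphism followed by a right translation.
    let α : MulAut G := MulEquiv.mk' (σ.trans (Equiv.mulRight (σ 1)⁻¹)) (by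
      intro a b
      simp [hf a b, mul_assoc])
    have hα : ∀ a, σ a = α a * σ 1 := by
      intro a
      exact (inv_mul_cancel_right (σ a) (σ 1)).symm
    refine op_mem_Hol_of_forall_exists _ fun g => ?_
    -- With b = α(θg) and k = σ(1), the element w = γ(b)(k)⁻¹bk has γ(w) = γ(b). Hence (ak) ∘ w =
    -- γ(b)(a)·b·k for all a, which is what `σ` makes of θ(hg) when a = α(θh).
    refine ⟨θ.symm ((γ (α (θ g)) (σ 1))⁻¹ * α (θ g) * σ 1), fun h => ?_⟩
    apply θ.injective
    rw [hθ]
    simp only [Equiv.Perm.mul_apply, Equiv.apply_symm_apply, circ]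
    rw [hθ h g, circ, hγ.map_circ_factor, hα, hα (θ h), map_mul, map_mul, hγ]
    simp [mul_assoc]
  have : Finite (SymLR G) := Finite.of_equiv _ opEquiv
  exact Subgroup.mem_normalizer_fintype key

theorem exists_isTwist_of_op_mem_NHol {θ : Equiv.Perm G} (hθ : op θ ∈ NHol G) (h1 : θ 1 = 1) :
    ∃ γ : G →* MulAut G, IsEquivariant γ ∧ IsTwist γ θ := by
  have hθ1 : θ.symm 1 = 1 := by rw [Equiv.symm_apply_eq, h1]
  -- Conjugates of right translations lie in the holomorph; this makes `δ` automorphism-valued.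
  have c1 : ∀ g a b : G, θ (θ.symm (a * b) * g) = θ (θ.symm a * g) * (θ g)⁻¹ * θ (θ.symm b * g) := by
    intro g a b
    have h2 := (Subgroup.mem_normalizer_iff.mp (inv_mem hθ) (rightReg G g)).mp (rightReg_mem_Hol g)
    have h3 : op (θ * (Equiv.mulRight g * θ.symm)) ∈ Hol G := h2
    have h4 := (op_mem_Hol_iff _).mp h3 a b
    simpa [hθ1] using h4
  -- The conjugate of an automorphism lies in the holomorph and fixes 1, so it is an automorphism;
  -- this gives equivariance.
  have c2 : ∀ (β : MulAut G) (g h : G),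
      θ.symm (β (θ (g * h))) = θ.symm (β (θ g)) * θ.symm (β (θ h)) := by
    intro β g h
    have h2 := (Subgroup.mem_normalizer_iff.mp hθ _).mp (op_mulAut_mem_Hol β)
    have h3 : op (θ.symm * ((β.toEquiv : Equiv.Perm G) * θ)) ∈ Hol G := h2
    have h4 := (op_mem_Hol_iff_of_map_one (by simp [h1, hθ1])).mp h3 g h
    simpa using h4
  let δ : G → MulAut G := fun a => MulEquiv.mk'
    (θ.symm.trans ((Equiv.mulRight (θ.symm a)).trans (θ.trans (Equiv.mulRight a⁻¹)))) (by
      intro g h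
      have := c1 (θ.symm a) g h
      simp only [Equiv.apply_symm_apply] at this
      simp [this, mul_assoc])
  have hδ : ∀ g h : G, θ (g * h) = δ (θ h) (θ g) * θ h := by
    intro g h
    change _ = θ (θ.symm (θ g) * θ.symm (θ h)) * (θ h)⁻¹ * θ h
    simp
  have eqv : ∀ (β : MulAut G) (a : G), δ (β a) = β * δ a * β⁻¹ := by
    intro β a
    rw [eq_mul_inv_iff_mul_eq]
    ext b
    obtain ⟨g, rfl⟩ := θ.surjective b
    obtain ⟨k, rfl⟩ := θ.surjective a
    have h2 := congrArg θ (c2 β g k)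
    rw [hδ _ (θ.symm (β (θ k)))] at h2
    simp only [Equiv.apply_symm_apply] at h2
    rw [hδ g k, map_mul] at h2
    exact (mul_right_cancel h2).symm
  -- Associativity of G, transported by `θ`. Equivariance then turns this anti-homomorphism law for
  -- ∘ into the homomorphism law for the original product.
  have hcirc : ∀ a b : G, δ (δ b a * b) = δ b * δ a := by
    intro a b
    obtain ⟨g, rfl⟩ := θ.surjective a
    obtain ⟨k, rfl⟩ := θ.surjective b
    ext c
    obtain ⟨h, rfl⟩ := θ.surjective c
    have h2 := hδ h (g * k)
    rw [← mul_assoc, hδ _ k, hδ h g, map_mul, hδ g k, mul_assoc] at h2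
    exact (mul_right_cancel h2).symm
  refine ⟨MonoidHom.mk' δ fun a b => ?_, eqv, hδ⟩
  have h2 := hcirc ((δ b)⁻¹ a) b
  rw [MulAut.apply_inv_self, eqv] at h2
  rw [h2]
  group

/-- Two permutations attached to the same `γ` have the same class in `T(G)`, and conversely. -/
theorem IsTwist.mk_eq_mk_iff {γ' : G →* MulAut G} {θ θ' : Equiv.Perm G} (h : IsTwist γ θ)
    (h' : IsTwist γ' θ') (hn : op θ ∈ NHol G) (hn' : op θ' ∈ NHol G) :
    (QuotientGroup.mk (⟨op θ, hn⟩ : NHol G) : T G) = QuotientGroup.mk (⟨op θ', hn'⟩ : NHol G) ↔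
      γ = γ' := by
  rw [QuotientGroup.eq, (Hol.normal_subgroupOf_NHol G).mem_comm_iff, Subgroup.mem_subgroupOf]
  change op (θ.symm * θ') ∈ Hol G ↔ _
  have hθ1 : θ.symm 1 = 1 := by rw [Equiv.symm_apply_eq, h.map_one]
  rw [op_mem_Hol_iff_of_map_one (by simp [h'.map_one, hθ1])]
  have key : (∀ a b : G, (θ.symm * θ') (a * b) = (θ.symm * θ') a * (θ.symm * θ') b) ↔ IsTwist γ θ' := by
    refine forall₂_congr fun a b => ?_
    rw [← θ.injective.eq_iff, h]
    simp
  rw [key]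
  exact ⟨fun k => k.eq_of_isTwist h', fun k => k ▸ h'⟩

theorem exists_mk_eq_of_map_one (q : T G) : ∃ (θ : Equiv.Perm G) (hθ : op θ ∈ NHol G),
    θ 1 = 1 ∧ QuotientGroup.mk (⟨op θ, hθ⟩ : NHol G) = q := by
  obtain ⟨⟨f, hf⟩, rfl⟩ := QuotientGroup.mk_surjective q
  obtain ⟨σ, rfl⟩ := op_surjective f
  have hr : rightReg G (σ 1)⁻¹ ∈ NHol G := Subgroup.le_normalizer (rightReg_mem_Hol _)
  refine ⟨Equiv.mulRight (σ 1)⁻¹ * σ, mul_mem hf hr, by simp, ?_⟩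
  rw [eq_comm, QuotientGroup.eq, Subgroup.mem_subgroupOf]
  change (op σ)⁻¹ * (op σ * rightReg G (σ 1)⁻¹) ∈ Hol G
  rw [inv_mul_cancel_left]
  exact rightReg_mem_Hol _

end Twist

/-! ### Normal form x^i y^j and the order of G_p -/

section Coordinates

/-- Pairs `(i, j)` standing for the element `x ^ i * y ^ j` of `G_p`. -/
@[ext]
structure GpCoord (p : ℕ) where
  /-- The exponent of `x`. -/
  i : ZMod (p ^ 2)
  /-- The exponent of `y`. -/
  j : ZMod (p ^ 2)

variable {p : ℕ}

theorem natCast_mul_self_eq_zero : (p : ZMod (p ^ 2)) * p = 0 := by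
  rw [← Nat.cast_mul, ← sq, ZMod.natCast_self]

namespace GpCoord

/-- From y^j x^k = x^((1-p)^j k) y^j, where (1-p)^j = 1 - pj modulo p². -/
instance : Mul (GpCoord p) := ⟨fun a b => ⟨a.i + b.i - p * a.j * b.i, a.j + b.j⟩⟩

instance : One (GpCoord p) := ⟨⟨0, 0⟩⟩

instance : Inv (GpCoord p) := ⟨fun a => ⟨-a.i - p * a.j * a.i, -a.j⟩⟩

@[simp] theorem mul_i (a b : GpCoord p) : (a * b).i = a.i + b.i - p * a.j * b.i := rfl

@[simp] theorem mul_j (a b : GpCoord p) : (a * b).j = a.j + b.j := rfl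

@[simp] theorem one_i : (1 : GpCoord p).i = 0 := rfl

@[simp] theorem one_j : (1 : GpCoord p).j = 0 := rfl

@[simp] theorem inv_i (a : GpCoord p) : a⁻¹.i = -a.i - p * a.j * a.i := rfl

@[simp] theorem inv_j (a : GpCoord p) : a⁻¹.j = -a.j := rfl

instance : Group (GpCoord p) := Group.ofLeftAxioms
  (fun a b c => by
    ext
    · simp only [mul_i, mul_j]
      linear_combination (-a.j * b.j * c.i) * natCast_mul_self_eq_zero (p := p)
    · simp only [mul_j, add_assoc])
  (fun a => by ext <;> simp)
  (fun a => by
    ext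
    · simp; ring
    · simp)

theorem pow_i_of_j_eq_zero {a : GpCoord p} (ha : a.j = 0) (n : ℕ) :
    (a ^ n).i = n * a.i ∧ (a ^ n).j = 0 := by
  induction n with
  | zero => simp
  | succ n ih => simp [pow_succ, ih, ha, add_mul]

theorem pow_j (a : GpCoord p) (n : ℕ) : (a ^ n).j = n * a.j := by
  induction n with
  | zero => simp
  | succ n ih => simp [pow_succ, ih, add_mul]

theorem zpow_j (a : GpCoord p) (n : ℤ) : (a ^ n).j = n * a.j := by
  cases n with
  | ofNat n => simp [pow_j]
  | negSucc n => simp [zpow_negSucc, pow_j]; ring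

theorem zpow_i_of_j_eq_zero {a : GpCoord p} (ha : a.j = 0) (n : ℤ) : (a ^ n).i = n * a.i := by
  cases n with
  | ofNat n => simp [pow_i_of_j_eq_zero ha]
  | negSucc n => simp [zpow_negSucc, pow_i_of_j_eq_zero ha]; ring

theorem zpow_i_of_i_eq_zero {a : GpCoord p} (ha : a.i = 0) (n : ℤ) : (a ^ n).i = 0 := by
  have h : ∀ n : ℕ, (a ^ n).i = 0 := by
    intro n
    induction n with
    | zero => simp
    | succ n ih => simp [pow_succ, ih, ha]
  cases n with
  | ofNat n => simp [h]
  | negSucc n => simp [zpow_negSucc, h]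

end GpCoord

namespace Gp

theorem x_pow_sq : Gp.x p ^ p ^ 2 = 1 :=
  PresentedGroup.one_of_mem (rels := Gp.rels p) (x := FreeGroup.of 0 ^ p ^ 2) (by simp [Gp.rels])

theorem y_pow_sq : Gp.y p ^ p ^ 2 = 1 :=
  PresentedGroup.one_of_mem (rels := Gp.rels p) (x := FreeGroup.of 1 ^ p ^ 2) (by simp [Gp.rels])

theorem conj_x : (Gp.y p)⁻¹ * Gp.x p * Gp.y p = Gp.x p ^ (1 + p : ℤ) := by
  have h : (Gp.x p)⁻¹ * (Gp.y p)⁻¹ * Gp.x p * Gp.y p * (Gp.x p ^ p)⁻¹ = 1 :=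
    PresentedGroup.one_of_mem (rels := Gp.rels p)
      (x := (FreeGroup.of 0)⁻¹ * (FreeGroup.of 1)⁻¹ * FreeGroup.of 0 * FreeGroup.of 1 *
        (FreeGroup.of 0 ^ p)⁻¹) (by simp [Gp.rels])
  rw [mul_inv_eq_one] at h
  rw [zpow_one_add, zpow_natCast, ← h]
  group

theorem x_zpow_eq {m n : ℤ} (h : (m : ZMod (p ^ 2)) = n) : Gp.x p ^ m = Gp.x p ^ n := by
  rw [ZMod.intCast_eq_intCast_iff] at h
  exact zpow_eq_zpow_iff_modEq.mpr (h.of_dvd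
    (Int.natCast_dvd_natCast.mpr (orderOf_dvd_of_pow_eq_one x_pow_sq)))

theorem y_zpow_eq {m n : ℤ} (h : (m : ZMod (p ^ 2)) = n) : Gp.y p ^ m = Gp.y p ^ n := by
  rw [ZMod.intCast_eq_intCast_iff] at h
  exact zpow_eq_zpow_iff_modEq.mpr (h.of_dvd
    (Int.natCast_dvd_natCast.mpr (orderOf_dvd_of_pow_eq_one y_pow_sq)))

theorem conj_x' : Gp.y p * Gp.x p * (Gp.y p)⁻¹ = Gp.x p ^ (1 - p : ℤ) := by
  have h : ((Gp.y p)⁻¹ * Gp.x p * Gp.y p) ^ (1 - p : ℤ) = Gp.x p := by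
    rw [conj_x, ← zpow_mul]
    refine (x_zpow_eq ?_).trans (zpow_one _)
    push_cast
    linear_combination -natCast_mul_self_eq_zero (p := p)
  have h2 := conj_zpow (a := (Gp.y p)⁻¹) (b := Gp.x p) (i := (1 - p : ℤ))
  rw [inv_inv, h] at h2
  nth_rw 1 [h2]
  group

theorem exists_eq_zpow (g : Gp p) : ∃ m n : ℤ, g = Gp.x p ^ m * Gp.y p ^ n := by
  have hg : g ∈ Subgroup.closure (Set.range (PresentedGroup.of (rels := Gp.rels p))) := by
    rw [PresentedGroup.closure_range_of]; trivial
  induction hg using Subgroup.closure_induction_left with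
  | one => exact ⟨0, 0, by simp⟩
  | mul_left a ha b _ ih =>
    obtain ⟨m, n, rfl⟩ := ih
    obtain ⟨k, rfl⟩ := ha
    fin_cases k
    · exact ⟨1 + m, n, by rw [zpow_one_add, mul_assoc]; rfl⟩
    · refine ⟨(1 - p) * m, 1 + n, ?_⟩
      rw [zpow_mul, ← conj_x', conj_zpow, zpow_one_add]
      change Gp.y p * _ = _
      group
  | inv_mul_cancel a ha b _ ih =>
    obtain ⟨m, n, rfl⟩ := ih
    obtain ⟨k, rfl⟩ := ha
    fin_cases k
    · refine ⟨-1 + m, n, ?_⟩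
      rw [zpow_add, zpow_neg_one, mul_assoc]; rfl
    · refine ⟨(1 + p) * m, -1 + n, ?_⟩
      have := conj_zpow (a := (Gp.y p)⁻¹) (b := Gp.x p) (i := m)
      rw [inv_inv] at this
      rw [zpow_mul, ← conj_x, this, zpow_add (Gp.y p)]
      change (Gp.y p)⁻¹ * _ = _
      group

/-- The homomorphism reading off the exponents of `x ^ i * y ^ j`. -/
def toCoord (p : ℕ) : Gp p →* GpCoord p :=
  PresentedGroup.toGroup (f := ![⟨1, 0⟩, ⟨0, 1⟩]) (by
    rintro r (rfl | rfl | rfl)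
    · ext
      · have h := (GpCoord.pow_i_of_j_eq_zero (a := (⟨1, 0⟩ : GpCoord p)) rfl (p ^ 2)).1
        rw [ZMod.natCast_self, zero_mul] at h
        simpa using h
      · simp [GpCoord.pow_j]
    · ext
      · simpa using GpCoord.zpow_i_of_i_eq_zero (a := (⟨0, 1⟩ : GpCoord p)) rfl (p ^ 2 : ℕ)
      · simp [GpCoord.pow_j, -Nat.cast_pow]
    · have h := GpCoord.pow_i_of_j_eq_zero (a := (⟨1, 0⟩ : GpCoord p)) rfl p
      ext <;> simp [h])

theorem toCoord_x : toCoord p (Gp.x p) = ⟨1, 0⟩ := by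
  simp [toCoord, Gp.x]

theorem toCoord_y : toCoord p (Gp.y p) = ⟨0, 1⟩ := by
  simp [toCoord, Gp.y]

theorem toCoord_zpow (m n : ℤ) :
    toCoord p (Gp.x p ^ m * Gp.y p ^ n) = ⟨m, n⟩ := by
  rw [map_mul, map_zpow, map_zpow, toCoord_x, toCoord_y]
  ext
  · rw [GpCoord.mul_i, GpCoord.zpow_i_of_j_eq_zero rfl, GpCoord.zpow_i_of_i_eq_zero rfl]
    simp
  · simp [GpCoord.zpow_j]

/-- The model shows that the exponents in the normal form are determined modulo p²; the relators
show that they matter only modulo p². -/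
theorem toCoord_bijective : Function.Bijective (toCoord p) := by
  constructor
  · rw [injective_iff_map_eq_one]
    intro g hg
    obtain ⟨m, n, rfl⟩ := exists_eq_zpow g
    rw [toCoord_zpow, GpCoord.mk.injEq] at hg
    rw [x_zpow_eq (n := 0) (by simpa using hg.1), y_zpow_eq (n := 0) (by simpa using hg.2)]
    simp
  · intro a
    obtain ⟨m, hm⟩ := ZMod.intCast_surjective a.i
    obtain ⟨n, hn⟩ := ZMod.intCast_surjective a.j
    exact ⟨_, (toCoord_zpow m n).trans (by rw [hm, hn])⟩

/-- The exponent of `x`. -/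
def ci (g : Gp p) : ZMod (p ^ 2) := (toCoord p g).i

/-- The exponent of `y`. -/
def cj (g : Gp p) : ZMod (p ^ 2) := (toCoord p g).j

/-- The element of `G_p` with given exponents. -/
noncomputable def mk (i j : ZMod (p ^ 2)) : Gp p :=
  (Equiv.ofBijective _ (toCoord_bijective (p := p))).symm ⟨i, j⟩

theorem toCoord_mk (i j : ZMod (p ^ 2)) : toCoord p (mk i j) = ⟨i, j⟩ :=
  (Equiv.ofBijective _ (toCoord_bijective (p := p))).apply_symm_apply ⟨i, j⟩

@[simp] theorem ci_mk (i j : ZMod (p ^ 2)) : ci (mk i j) = i := by rw [ci, toCoord_mk]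

@[simp] theorem cj_mk (i j : ZMod (p ^ 2)) : cj (mk i j) = j := by rw [cj, toCoord_mk]

theorem coord_ext {g h : Gp p} (hi : ci g = ci h) (hj : cj g = cj h) : g = h :=
  toCoord_bijective.1 (GpCoord.ext hi hj)

@[simp] theorem ci_mul (g h : Gp p) : ci (g * h) = ci g + ci h - p * cj g * ci h := by
  simp [ci, cj]

@[simp] theorem cj_mul (g h : Gp p) : cj (g * h) = cj g + cj h := by simp [cj]

@[simp] theorem ci_one : ci (1 : Gp p) = 0 := by simp [ci]

@[simp] theorem cj_one : cj (1 : Gp p) = 0 := by simp [cj]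

@[simp] theorem ci_x : ci (Gp.x p) = 1 := by simp [ci, toCoord_x]

@[simp] theorem cj_x : cj (Gp.x p) = 0 := by simp [cj, toCoord_x]

@[simp] theorem ci_y : ci (Gp.y p) = 0 := by simp [ci, toCoord_y]

@[simp] theorem cj_y : cj (Gp.y p) = 1 := by simp [cj, toCoord_y]

@[simp] theorem cj_pow (g : Gp p) (n : ℕ) : cj (g ^ n) = n * cj g := by
  simp [cj, GpCoord.pow_j]

@[simp] theorem ci_x_pow (n : ℕ) : ci (Gp.x p ^ n) = n := by
  simp [ci, toCoord_x, GpCoord.pow_i_of_j_eq_zero]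

theorem y_zpow (n : ℤ) : Gp.y p ^ n = mk 0 n := by
  have h := toCoord_zpow (p := p) 0 n
  rw [zpow_zero, one_mul] at h
  apply coord_ext <;> simp [ci, cj, h, toCoord_mk]

@[simp] theorem ci_y_pow (n : ℕ) : ci (Gp.y p ^ n) = 0 := by
  rw [← zpow_natCast, y_zpow, ci_mk]

theorem eq_x_pow_mul_y_pow [NeZero p] (g : Gp p) :
    g = Gp.x p ^ (ci g).val * Gp.y p ^ (cj g).val := by
  apply coord_ext <;> simp

theorem natCard_eq : Nat.card (Gp p) = p ^ 4 := by
  let e : GpCoord p ≃ ZMod (p ^ 2) × ZMod (p ^ 2) :=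
    ⟨fun a => (a.i, a.j), fun a => ⟨a.1, a.2⟩, fun _ => rfl, fun _ => rfl⟩
  rw [Nat.card_congr ((Equiv.ofBijective _ (toCoord_bijective (p := p))).trans e), Nat.card_prod,
    Nat.card_zmod, ← pow_add]

instance [NeZero p] : Finite (Gp p) :=
  Nat.finite_of_card_ne_zero (by rw [natCard_eq]; exact pow_ne_zero _ (NeZero.ne p))

end Gp

end Coordinates

/-! ### Arithmetic modulo p², automorphisms of G_p, and the maps γ_{s,t} -/

section Gamma

variable {p : ℕ}

section Ring

/-- The inverse of `2`. -/
def half (p : ℕ) : ZMod (p ^ 2) := (2 : ZMod (p ^ 2))⁻¹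

variable [Fact p.Prime]

/-- Reduction modulo `p`. -/
def redP (p : ℕ) : ZMod (p ^ 2) →+* ZMod p := ZMod.castHom (dvd_pow_self p two_ne_zero) (ZMod p)

/-- Lets parameters in F_p enter identities over Z/p²: they always occur multiplied by p. -/
theorem natCast_mul_eq_zero_iff {z : ZMod (p ^ 2)} : (p : ZMod (p ^ 2)) * z = 0 ↔ redP p z = 0 := by
  obtain ⟨n, rfl⟩ := ZMod.natCast_zmod_surjective z
  rw [map_natCast, ← Nat.cast_mul, ZMod.natCast_eq_zero_iff, ZMod.natCast_eq_zero_iff, sq]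
  exact Nat.mul_dvd_mul_iff_left (Fact.out : p.Prime).pos

theorem natCast_mul_eq_iff {z w : ZMod (p ^ 2)} :
    (p : ZMod (p ^ 2)) * z = (p : ZMod (p ^ 2)) * w ↔ redP p z = redP p w := by
  rw [← sub_eq_zero, ← mul_sub, natCast_mul_eq_zero_iff, map_sub, sub_eq_zero]

theorem exists_eq_natCast_mul {z : ZMod (p ^ 2)} (hz : (p : ZMod (p ^ 2)) * z = 0) :
    ∃ s : ZMod p, z = (p : ZMod (p ^ 2)) * (s.val : ZMod (p ^ 2)) := by
  rw [natCast_mul_eq_zero_iff] at hz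
  obtain ⟨n, rfl⟩ := ZMod.natCast_zmod_surjective z
  rw [map_natCast, ZMod.natCast_eq_zero_iff] at hz
  obtain ⟨k, rfl⟩ := hz
  refine ⟨k, ?_⟩
  rw [Nat.cast_mul, natCast_mul_eq_iff]
  simp

theorem mul_eq_zero_of_natCast_mul {z w : ZMod (p ^ 2)} (hz : (p : ZMod (p ^ 2)) * z = 0)
    (hw : (p : ZMod (p ^ 2)) * w = 0) : z * w = 0 := by
  obtain ⟨s, rfl⟩ := exists_eq_natCast_mul hz
  linear_combination (s.val : ZMod (p ^ 2)) * hw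

theorem redP_natCast_val (s : ZMod p) : redP p (s.val : ZMod (p ^ 2)) = s := by simp

theorem natCast_mul_val_add (s t : ZMod p) :
    (p : ZMod (p ^ 2)) * ((s + t).val : ZMod (p ^ 2)) =
      (p : ZMod (p ^ 2)) * ((s.val : ZMod (p ^ 2)) + (t.val : ZMod (p ^ 2))) := by
  rw [natCast_mul_eq_iff, map_add]
  simp only [redP_natCast_val]

theorem natCast_ne_zero : (p : ZMod (p ^ 2)) ≠ 0 := by
  intro h
  rw [← mul_one (p : ZMod (p ^ 2)), natCast_mul_eq_zero_iff, map_one] at h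
  exact one_ne_zero h

theorem isUnit_of_redP {z : ZMod (p ^ 2)} (hz : redP p z ≠ 0) : ∃ w, z * w = 1 := by
  obtain ⟨n, rfl⟩ := ZMod.natCast_zmod_surjective z
  rw [map_natCast, Ne, ZMod.natCast_eq_zero_iff] at hz
  refine ⟨_, ZMod.coe_mul_inv_eq_one n (Nat.Coprime.pow_right 2 ?_)⟩
  exact (((Fact.out : p.Prime).coprime_iff_not_dvd).mpr hz).symm

theorem two_mul_half (hp : 2 < p) : 2 * half p = 1 := by
  have h : Nat.Coprime 2 (p ^ 2) := Nat.Coprime.pow_right 2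
    ((Nat.coprime_primes Nat.prime_two Fact.out).mpr hp.ne)
  exact_mod_cast ZMod.coe_mul_inv_eq_one 2 h

end Ring

namespace Gp

/-- The formula for `γ_{s,t}(g)`, with `s`, `t` lifted to `ZMod (p ^ 2)`. -/
noncomputable def gammaFun (S T : ZMod (p ^ 2)) (g h : Gp p) : Gp p :=
  mk (ci h + p * (T * cj g * ci h + S * ci g * cj h)) (cj h + p * ((S + T) * cj g * cj h))

theorem gammaFun_neg (S T : ZMod (p ^ 2)) (g h : Gp p) :
    gammaFun (-S) (-T) g (gammaFun S T g h) = h := by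
  have hpp := natCast_mul_self_eq_zero (p := p)
  apply coord_ext <;> simp only [gammaFun, ci_mk, cj_mk] <;> grind

/-- The automorphism `γ_{s,t}(g)`. -/
noncomputable def gammaAut (S T : ZMod (p ^ 2)) (g : Gp p) : MulAut (Gp p) where
  toFun := gammaFun S T g
  invFun := gammaFun (-S) (-T) g
  left_inv := gammaFun_neg S T g
  right_inv h := by simpa using gammaFun_neg (-S) (-T) g h
  map_mul' h k := by
    have hpp := natCast_mul_self_eq_zero (p := p)
    apply coord_ext <;> simp only [gammaFun, ci_mk, cj_mk, ci_mul, cj_mul] <;> grind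

/-- The homomorphism `γ_{s,t}`. -/
noncomputable def gammaHom (S T : ZMod (p ^ 2)) : Gp p →* MulAut (Gp p) :=
  MonoidHom.mk' (gammaAut S T) fun g h => by
    have hpp := natCast_mul_self_eq_zero (p := p)
    ext k
    change gammaFun S T (g * h) k = gammaFun S T g (gammaFun S T h k)
    apply coord_ext <;> simp only [gammaFun, ci_mk, cj_mk, ci_mul, cj_mul] <;> grind

@[simp] theorem ci_gammaHom (S T : ZMod (p ^ 2)) (g h : Gp p) : ci (gammaHom S T g h) =
    ci h + p * (T * cj g * ci h + S * ci g * cj h) := ci_mk _ _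

@[simp] theorem cj_gammaHom (S T : ZMod (p ^ 2)) (g h : Gp p) : cj (gammaHom S T g h) =
    cj h + p * ((S + T) * cj g * cj h) := cj_mk _ _

section Prime

variable [Fact p.Prime]

/-- The correction is p times the binomial coefficient n(n-1)/2; halving needs p odd. -/
theorem ci_pow (hp : 2 < p) (g : Gp p) (n : ℕ) :
    ci (g ^ n) = n * ci g - p * (half p * (n ^ 2 - n)) * ci g * cj g := by
  have h2 := two_mul_half hp
  induction n with
  | zero => simp
  | succ n ih =>
    rw [pow_succ g n, ci_mul, cj_pow, ih]
    push_cast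
    linear_combination (p * n * cj g * ci g) * h2

theorem ci_pow_mul (hp : 2 < p) (g : Gp p) (n : ℕ) : ci (g ^ (p * n)) = p * n * ci g := by
  rw [ci_pow hp]
  push_cast
  linear_combination (-(half p * (p * n ^ 2 - n)) * ci g * cj g) *
    natCast_mul_self_eq_zero (p := p)

/-- Automorphisms preserve the exponent of `y` modulo `p`. -/
theorem aut_x_y (β : MulAut (Gp p)) (hp : 2 < p) :
    (p : ZMod (p ^ 2)) * cj (β (Gp.x p)) = 0 ∧ (p : ZMod (p ^ 2)) * cj (β (Gp.y p)) = p := by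
  have h : Gp.x p * Gp.y p = Gp.y p * (Gp.x p * Gp.x p ^ (p * 1)) := by
    apply coord_ext <;> simp
    linear_combination natCast_mul_self_eq_zero (p := p)
  have h1 := congrArg β h
  rw [map_mul, map_mul, map_mul, map_pow] at h1
  have hi := congrArg ci h1
  have hj := congrArg cj h1
  simp only [ci_mul, cj_mul, cj_pow, ci_pow_mul hp] at hi hj
  push_cast at hi hj
  have hj' : (p : ZMod (p ^ 2)) * cj (β (Gp.x p)) = 0 := by linear_combination -hj
  refine ⟨hj', ?_⟩
  -- Otherwise `β` would kill x^p. As this exponent is a unit, it can be cancelled from the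
  -- x-coordinate of the image of xy = yx^(1+p).
  have hne : redP p (ci (β (Gp.x p))) ≠ 0 := by
    intro h0
    rw [← natCast_mul_eq_zero_iff] at h0
    have h2 : β (Gp.x p ^ (p * 1)) = 1 := by
      rw [map_pow]
      apply coord_ext
      · rw [ci_pow_mul hp]
        simpa using h0
      · simpa using hj'
    have h3 := congrArg ci ((map_eq_one_iff β β.injective).mp h2)
    simp at h3
    exact natCast_ne_zero h3
  obtain ⟨w, hw⟩ := isUnit_of_redP hne
  have hpp := natCast_mul_self_eq_zero (p := p)
  grind

/-- An automorphism in coordinates. -/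
theorem aut_coord (β : MulAut (Gp p)) (hp : 2 < p) (g : Gp p) :
    ci (β g) = ci (β (Gp.x p)) * ci g +
      ci (β (Gp.y p)) * (cj g - p * (half p * (cj g ^ 2 - cj g))) ∧
    cj (β g) = cj (β (Gp.x p)) * ci g + cj (β (Gp.y p)) * cj g := by
  obtain ⟨h1, h2⟩ := aut_x_y β hp
  have h := congrArg β (eq_x_pow_mul_y_pow g)
  rw [map_mul, map_pow, map_pow] at h
  have hi := congrArg ci h
  have hj := congrArg cj h
  simp only [ci_mul, cj_mul, cj_pow, ci_pow hp, ZMod.natCast_val, ZMod.cast_id', id_eq] at hi hj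
  constructor
  · rw [hi]
    generalize cj (β (Gp.x p)) = B at *
    generalize cj (β (Gp.y p)) = E at *
    generalize ci (β (Gp.x p)) = A at *
    generalize ci (β (Gp.y p)) = C at *
    generalize half p = k at *
    linear_combination (-k * (ci g ^ 2 - ci g) * A - ci g * C * cj g + ci g * p * (k * (cj g ^ 2 - cj g)) * C * E) * h1 - k * (cj g ^ 2 - cj g) * C * h2
  · rw [hj]; ring

theorem natCast_mul_cj_aut (β : MulAut (Gp p)) (hp : 2 < p) (g : Gp p) :
    (p : ZMod (p ^ 2)) * cj (β g) = p * cj g := by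
  obtain ⟨h1, h2⟩ := aut_x_y β hp
  rw [(aut_coord β hp g).2]
  linear_combination ci g * h1 + cj g * h2

/-- γ(g)(h) is expressed by powers of g and h whose exponents depend only on the y-exponents modulo
p, and automorphisms preserve those. -/
theorem gammaHom_isEquivariant (hp : 2 < p) (S T : ZMod (p ^ 2)) :
    IsEquivariant (gammaHom (p := p) S T) := by
  have hpp := natCast_mul_self_eq_zero (p := p)
  intro β g
  rw [eq_mul_inv_iff_mul_eq]
  ext h
  have key : gammaHom S T g h = h * h ^ (p * (T * cj g).val) * g ^ (p * (S * cj h).val) := by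
    apply coord_ext
    · simp only [ci_gammaHom, ci_mul, ci_pow_mul hp, cj_mul, cj_pow, Nat.cast_mul,
        ZMod.natCast_val, ZMod.cast_id', id_eq]
      grind
    · simp only [cj_gammaHom, cj_mul, cj_pow, Nat.cast_mul,
        ZMod.natCast_val, ZMod.cast_id', id_eq]
      grind
  rw [MulAut.mul_apply, MulAut.mul_apply, key]
  have hg := natCast_mul_cj_aut β hp g
  have hh := natCast_mul_cj_aut β hp h
  apply coord_ext
  · simp only [map_mul, map_pow, ci_gammaHom, ci_mul, ci_pow_mul hp, cj_mul, cj_pow, Nat.cast_mul,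
        ZMod.natCast_val, ZMod.cast_id', id_eq]
    grind
  · simp only [map_mul, map_pow, cj_gammaHom, cj_mul, cj_pow, Nat.cast_mul,
        ZMod.natCast_val, ZMod.cast_id', id_eq]
    grind

end Prime

end Gp

end Gamma

/-! ### Every equivariant γ is some γ_{s,t} -/

section Classification

variable {p : ℕ}

namespace Gp

/-- The homomorphism `γ_{s,t}`, for `s`, `t` in `F_p`. -/
noncomputable def gammaST (s t : ZMod p) : Gp p →* MulAut (Gp p) := gammaHom s.val t.val

theorem ci_gammaST (s t : ZMod p) (g h : Gp p) : ci (gammaST s t g h) =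
    ci h + p * (t.val * cj g * ci h + s.val * ci g * cj h) := ci_gammaHom _ _ _ _

theorem cj_gammaST (s t : ZMod p) (g h : Gp p) : cj (gammaST s t g h) =
    cj h + p * ((s.val + t.val) * cj g * cj h) := cj_gammaHom _ _ _ _

variable [Fact p.Prime]

theorem gammaST_isEquivariant (hp : 2 < p) (s t : ZMod p) : IsEquivariant (gammaST s t) :=
  gammaHom_isEquivariant hp _ _

theorem mulAut_ext {α β : MulAut (Gp p)} (hx : α (Gp.x p) = β (Gp.x p))
    (hy : α (Gp.y p) = β (Gp.y p)) : α = β := by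
  ext g
  rw [eq_x_pow_mul_y_pow g]
  simp only [map_mul, map_pow, hx, hy]

theorem gamma_ext {γ γ' : Gp p →* MulAut (Gp p)} (hx : γ (Gp.x p) = γ' (Gp.x p))
    (hy : γ (Gp.y p) = γ' (Gp.y p)) : γ = γ' := by
  refine MonoidHom.ext fun g => ?_
  rw [eq_x_pow_mul_y_pow g]
  simp only [map_mul, map_pow, hx, hy]

theorem isGamma_gammaST (hp : 2 < p) (s t : ZMod p) : IsGamma p s t (gammaST s t) where
  equivariant := gammaST_isEquivariant hp s t
  x_x := by apply coord_ext <;> simp [ci_gammaST, cj_gammaST]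
  x_y := by apply coord_ext <;> simp [ci_gammaST, cj_gammaST]
  y_x := by apply coord_ext <;> simp [ci_gammaST, cj_gammaST]
  y_y := by
    have h := natCast_mul_val_add s t
    apply coord_ext
    · simp [ci_gammaST]
    · simp only [cj_gammaST, cj_y, cj_pow, Nat.cast_add, Nat.cast_mul, Nat.cast_one, h]
      ring

theorem _root_.IsGamma.eq_gammaST (hp : 2 < p) {s t : ZMod p} {γ : Gp p →* MulAut (Gp p)}
    (h : IsGamma p s t γ) : γ = gammaST s t := by
  have h' := isGamma_gammaST hp s t
  exact gamma_ext (mulAut_ext (h.x_x.trans h'.x_x.symm) (h.x_y.trans h'.x_y.symm))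
    (mulAut_ext (h.y_x.trans h'.y_x.symm) (h.y_y.trans h'.y_y.symm))

/-- The automorphism `x ↦ x²`, `y ↦ y`. -/
noncomputable def squareAut (hp : 2 < p) : MulAut (Gp p) where
  toFun g := mk (2 * ci g) (cj g)
  invFun g := mk (half p * ci g) (cj g)
  left_inv g := by
    apply coord_ext
    · simp only [ci_mk]
      linear_combination ci g * two_mul_half hp
    · simp
  right_inv g := by
    apply coord_ext
    · simp only [ci_mk]
      linear_combination ci g * two_mul_half hp
    · simp
  map_mul' g h := by
    apply coord_ext
    · simp; ring
    · simp

/-- The automorphism `x ↦ x`, `y ↦ x y`. -/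
noncomputable def shearAut (hp : 2 < p) : MulAut (Gp p) where
  toFun g := mk (ci g + cj g - p * (half p * (cj g ^ 2 - cj g))) (cj g)
  invFun g := mk (ci g - cj g + p * (half p * (cj g ^ 2 - cj g))) (cj g)
  left_inv g := by
    apply coord_ext
    · simp only [ci_mk, cj_mk]; ring
    · simp
  right_inv g := by
    apply coord_ext
    · simp only [ci_mk, cj_mk]; ring
    · simp
  map_mul' g h := by
    have h2 := two_mul_half hp
    have hpp := natCast_mul_self_eq_zero (p := p)
    apply coord_ext
    · simp
      grind
    · simp

theorem ci_squareAut (hp : 2 < p) (g : Gp p) : ci (squareAut hp g) = 2 * ci g := ci_mk _ _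

theorem cj_squareAut (hp : 2 < p) (g : Gp p) : cj (squareAut hp g) = cj g := cj_mk _ _

theorem ci_shearAut (hp : 2 < p) (g : Gp p) :
    ci (shearAut hp g) = ci g + cj g - p * (half p * (cj g ^ 2 - cj g)) := ci_mk _ _

theorem cj_shearAut (hp : 2 < p) (g : Gp p) : cj (shearAut hp g) = cj g := cj_mk _ _

variable {γ : Gp p →* MulAut (Gp p)}

/-- `squareAut` fixes y, so it commutes with γ(y). Comparing eigenvalues 1 and 2 removes the mixed
exponents. -/
theorem _root_.IsEquivariant.apply_y (hp : 2 < p) (hγ : IsEquivariant γ) :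
    cj (γ (Gp.y p) (Gp.x p)) = 0 ∧ ci (γ (Gp.y p) (Gp.y p)) = 0 := by
  have hf : squareAut hp (Gp.y p) = Gp.y p := by
    apply coord_ext <;> simp [ci_squareAut, cj_squareAut]
  have h1 := congrArg cj (hγ.comm_of_fixed hf (Gp.x p))
  have h2 := congrArg ci (hγ.comm_of_fixed hf (Gp.y p))
  rw [(aut_coord (γ (Gp.y p)) hp _).2, cj_squareAut, ci_squareAut, cj_squareAut] at h1
  rw [hf, ci_squareAut] at h2
  simp only [ci_x, cj_x] at h1
  constructor
  · linear_combination h1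
  · linear_combination -h2

/-- The shear fixes x, so γ(x) maps x to a power of x. With M = γ(x) and S = `squareAut`,
equivariance reads M²S = SM: on x it gives M(x²) = x², and on y it makes the y-exponent e
idempotent, with e = 1 modulo p. -/
theorem _root_.IsEquivariant.apply_x (hp : 2 < p) (hγ : IsEquivariant γ) :
    γ (Gp.x p) (Gp.x p) = Gp.x p ∧ cj (γ (Gp.x p) (Gp.y p)) = 1 := by
  obtain ⟨hb, he⟩ := aut_x_y (γ (Gp.x p)) hp
  have hf : shearAut hp (Gp.x p) = Gp.x p := by
    apply coord_ext <;> simp [ci_shearAut, cj_shearAut]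
  have hs : squareAut hp (Gp.x p) = Gp.x p ^ 2 := by
    apply coord_ext <;> simp [ci_squareAut, cj_squareAut]
  have h1 := congrArg ci (hγ.comm_of_fixed hf (Gp.x p))
  rw [hf, ci_shearAut] at h1
  have hb0 : cj (γ (Gp.x p) (Gp.x p)) = 0 := by
    linear_combination -h1 + (half p * (cj (γ (Gp.x p) (Gp.x p)) - 1)) * hb
  have h2 := hγ (squareAut hp) (Gp.x p)
  rw [hs, map_pow, sq, eq_mul_inv_iff_mul_eq] at h2
  have h3 : ∀ k, γ (Gp.x p) (γ (Gp.x p) (squareAut hp k)) = squareAut hp (γ (Gp.x p) k) :=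
    fun k => congrArg (fun f : MulAut (Gp p) => f k) h2
  have hM := aut_coord (γ (Gp.x p)) hp
  have hx := h3 (Gp.x p)
  have hx2 : squareAut hp (γ (Gp.x p) (Gp.x p)) = γ (Gp.x p) (Gp.x p ^ 2) := by
    apply coord_ext
    · rw [ci_squareAut, (hM (Gp.x p ^ 2)).1]
      simp; ring
    · rw [cj_squareAut, (hM (Gp.x p ^ 2)).2]
      simp [hb0]
  rw [hx2, hs] at hx
  have hx3 := congrArg ci ((γ (Gp.x p)).injective hx)
  rw [(hM (Gp.x p ^ 2)).1] at hx3
  simp at hx3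
  constructor
  · apply coord_ext
    · rw [ci_x]
      linear_combination half p * hx3 - (ci (γ (Gp.x p) (Gp.x p)) - 1) * two_mul_half hp
    · rw [hb0, cj_x]
  · have hy : squareAut hp (Gp.y p) = Gp.y p := by
      apply coord_ext <;> simp [ci_squareAut, cj_squareAut]
    have h4 := congrArg cj (h3 (Gp.y p))
    rw [hy, cj_squareAut, (hM (γ (Gp.x p) (Gp.y p))).2, hb0] at h4
    have h5 : (p : ZMod (p ^ 2)) * (cj (γ (Gp.x p) (Gp.y p)) - 1) = 0 := by
      linear_combination he
    have h6 := mul_eq_zero_of_natCast_mul h5 h5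
    linear_combination h4 - h6

theorem exists_eq_gammaST (hp : 2 < p) (hγ : IsEquivariant γ) :
    ∃ s t : ZMod p, γ = gammaST s t := by
  obtain ⟨hB, hC⟩ := hγ.apply_y hp
  obtain ⟨hMx, he⟩ := hγ.apply_x hp
  obtain ⟨-, hE⟩ := aut_x_y (γ (Gp.y p)) hp
  have hM := aut_coord (γ (Gp.x p)) hp
  have hN := aut_coord (γ (Gp.y p)) hp
  rw [hMx, he] at hM
  rw [hB, hC] at hN
  simp only [ci_x, cj_x, one_mul, zero_mul, zero_add, add_zero] at hM hN
  generalize hc : ci (γ (Gp.x p) (Gp.y p)) = c at *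
  generalize hA' : ci (γ (Gp.y p) (Gp.x p)) = A at *
  generalize hE' : cj (γ (Gp.y p) (Gp.y p)) = E at *
  -- `γ (x y) = γ x γ y` is conjugate to `γ y` by the shear
  have hsy : shearAut hp (Gp.y p) = Gp.x p * Gp.y p := by
    apply coord_ext <;> simp [ci_shearAut, cj_shearAut]
  have h1 := hγ (shearAut hp) (Gp.y p)
  rw [hsy, map_mul, eq_mul_inv_iff_mul_eq] at h1
  have h2 := congrArg (fun f : MulAut (Gp p) => ci (f (Gp.y p))) h1
  simp only [MulAut.mul_apply] at h2
  rw [ci_shearAut, (hM _).1, (hN _).1, (hN _).2, (hN _).1, (hN _).2, hsy] at h2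
  simp only [ci_mul, cj_mul, ci_x, ci_y, cj_x, cj_y] at h2
  have hA : A = E - c * E := by
    have hpE2 : (p : ZMod (p ^ 2)) * (E ^ 2 - E) = 0 := by linear_combination E * hE
    linear_combination h2 + (-half p + c * half p) * hpE2
  -- `x y = y x ^ (1 + p)`
  have h3 : Gp.x p * Gp.y p = Gp.y p * (Gp.x p * Gp.x p ^ p) := by
    apply coord_ext <;> simp
    linear_combination natCast_mul_self_eq_zero (p := p)
  have hMp : ∀ n : ℕ, (γ (Gp.x p) ^ n) (Gp.y p) = mk ((n : ZMod (p ^ 2)) * c) 1 := by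
    intro n
    induction n with
    | zero => apply coord_ext <;> simp
    | succ n ih =>
      rw [pow_succ', MulAut.mul_apply, ih]
      apply coord_ext
      · rw [(hM _).1]
        simp
        ring
      · rw [(hM _).2, cj_mk, cj_mk]
  have h4 := congrArg (fun g => ci (γ g (Gp.y p))) h3
  simp only [map_mul, map_pow, MulAut.mul_apply, hMp] at h4
  rw [(hM _).1, (hN _).1, (hN _).2, (hN _).1, (hM _).1] at h4
  simp only [ci_y, cj_y, ci_mk, cj_mk] at h4
  have hEu : ∃ F, E * F = 1 := by
    apply isUnit_of_redP
    have h5 := (natCast_mul_eq_iff (p := p) (z := E) (w := 1)).mp (by rw [hE, mul_one])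
    rw [h5, map_one]
    exact one_ne_zero
  obtain ⟨F, hF⟩ := hEu
  -- Here `h4` says cE = A(1+p)c. Inserting A = E - cE and cancelling the unit E leaves c² = pc -
  -- pc², which is multiplied by p.
  have hpc2 : (p : ZMod (p ^ 2)) * (c * c) = 0 := by
    have hpp := natCast_mul_self_eq_zero (p := p)
    grind
  have hpc : (p : ZMod (p ^ 2)) * c = 0 := by
    rw [natCast_mul_eq_zero_iff] at hpc2 ⊢
    rw [map_mul] at hpc2
    exact mul_self_eq_zero.mp hpc2
  obtain ⟨s, hs⟩ := exists_eq_natCast_mul hpc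
  obtain ⟨r, hr⟩ := exists_eq_natCast_mul (z := E - 1) (by linear_combination hE)
  -- With c = ps and E = 1 + pr, A = E - cE becomes 1 + p(r-s), so t = r - s.
  refine ⟨s, r - s, gamma_ext (mulAut_ext ?_ ?_) (mulAut_ext ?_ ?_)⟩
  · rw [hMx, (isGamma_gammaST hp _ _).x_x]
  · apply coord_ext
    · rw [hc, ci_gammaST, hs]; simp
    · rw [he, cj_gammaST]; simp
  · have h6 := natCast_mul_val_add s (r - s)
    rw [add_sub_cancel] at h6
    apply coord_ext
    · rw [hA', ci_gammaST, hA]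
      simp only [ci_x, cj_x, ci_y, cj_y]
      linear_combination (1 - c) * hr + h6 - hs - (r.val : ZMod (p ^ 2)) * hpc
    · rw [hB, cj_gammaST]; simp
  · have h6 := natCast_mul_val_add s (r - s)
    rw [add_sub_cancel] at h6
    apply coord_ext
    · rw [hC, ci_gammaST]; simp
    · rw [hE', cj_gammaST]
      simp only [cj_y]
      linear_combination hr + h6

end Gp

end Classification

/-! ### The maps θ_{d,s} and their products -/

section Theta

variable {p : ℕ}

namespace Gp

/-- The formula for `θ_{d,s}`, with all exponents lifted to `ZMod (p ^ 2)`. -/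
noncomputable def thetaFun (D S T : ZMod (p ^ 2)) (g : Gp p) : Gp p :=
  mk (ci g + p * (T * D * ci g * cj g))
    (D * cj g + p * ((S + T) * D ^ 2 * (half p * (cj g ^ 2 - cj g))))

theorem thetaFun_injective {D E : ZMod (p ^ 2)} (S T : ZMod (p ^ 2)) (hD : D * E = 1) :
    Function.Injective (thetaFun D S T) := by
  have hpp := natCast_mul_self_eq_zero (p := p)
  intro g k h
  have h1 := congrArg ci h
  have h2 := congrArg cj h
  simp only [thetaFun, ci_mk, cj_mk] at h1 h2
  -- Multiplying by p kills the corrections; the agreement modulo p then cancels them in the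
  -- original equations.
  have h3 : (p : ZMod (p ^ 2)) * cj g = p * cj k := by grind
  have h4 : (p : ZMod (p ^ 2)) * cj g ^ 2 = p * cj k ^ 2 := by grind
  have h5 : cj g = cj k := by grind
  have h6 : (p : ZMod (p ^ 2)) * ci g = p * ci k := by grind
  exact coord_ext (by grind) h5

variable [Fact p.Prime]

theorem gammaST_inj {s t s' t' : ZMod p} (h : gammaST s t = gammaST s' t') : s = s' ∧ t = t' := by
  have h1 := congrArg (fun γ : Gp p →* MulAut (Gp p) => ci (γ (Gp.x p) (Gp.y p))) h
  have h2 := congrArg (fun γ : Gp p →* MulAut (Gp p) => ci (γ (Gp.y p) (Gp.x p))) h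
  simp only [ci_gammaST, ci_x, ci_y, cj_x, cj_y, mul_zero, mul_one, zero_add,
    add_zero, add_right_inj, natCast_mul_eq_iff, redP_natCast_val] at h1 h2
  exact ⟨h1, h2⟩

theorem _root_.IsTwist.ext {γ : Gp p →* MulAut (Gp p)} {θ θ' : Equiv.Perm (Gp p)}
    (h : IsTwist γ θ) (h' : IsTwist γ θ') (hx : θ (Gp.x p) = θ' (Gp.x p))
    (hy : θ (Gp.y p) = θ' (Gp.y p)) : θ = θ' := by
  have hp : ∀ g : Gp p, θ g = θ' g → ∀ n : ℕ, θ (g ^ n) = θ' (g ^ n) := by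
    intro g hg n
    induction n with
    | zero => rw [pow_zero, h.map_one, h'.map_one]
    | succ n ih => rw [pow_succ, h, h', ih, hg]
  ext g : 1
  rw [eq_x_pow_mul_y_pow g, h, h', hp _ hx, hp _ hy]

/-- The hypothesis, D(T-S+1) = 1 modulo p, matches the ∘-commutator of x and y^d with [x, y]; it is
the origin of t = d' + s - 1. -/
theorem thetaFun_mul (hp : 2 < p) {D S T : ZMod (p ^ 2)}
    (h : (p : ZMod (p ^ 2)) * ((T - S + 1) * D) = (p : ZMod (p ^ 2))) (g k : Gp p) :
    thetaFun D S T (g * k) = circ (gammaHom S T) (thetaFun D S T g) (thetaFun D S T k) := by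
  have hpp := natCast_mul_self_eq_zero (p := p)
  have h2 := two_mul_half hp
  apply coord_ext
  · simp only [thetaFun, circ, ci_mul, cj_mul, ci_mk, cj_mk, ci_gammaHom, cj_gammaHom]
    grind
  · simp only [thetaFun, circ, cj_mul, cj_mk, cj_gammaHom]
    grind

theorem isTheta_iff (hp : 2 < p) (d : ℤ) (s : ZMod p) (θ : Equiv.Perm (Gp p)) :
    IsTheta p d s θ ↔ IsTwist (gammaST s ((d : ZMod p)⁻¹ + s - 1)) θ ∧
      θ (Gp.x p) = Gp.x p ∧ θ (Gp.y p) = Gp.y p ^ d := by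
  constructor
  · rintro ⟨γ, hγ, h⟩
    rwa [← hγ.eq_gammaST hp]
  · intro h
    exact ⟨_, isGamma_gammaST hp _ _, h⟩

theorem natCast_mul_lift {d : ℤ} (hd : (d : ZMod p) ≠ 0) (s : ZMod p) :
    (p : ZMod (p ^ 2)) * (((((d : ZMod p)⁻¹ + s - 1).val : ZMod (p ^ 2)) -
      (s.val : ZMod (p ^ 2)) + 1) * (d : ZMod (p ^ 2))) = p := by
  have h := (natCast_mul_eq_iff (p := p) (z := ((((d : ZMod p)⁻¹ + s - 1).val : ZMod (p ^ 2)) -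
      (s.val : ZMod (p ^ 2)) + 1) * (d : ZMod (p ^ 2))) (w := 1)).mpr (by
    rw [map_mul, map_add, map_sub, redP_natCast_val, redP_natCast_val, map_one, map_intCast]
    field_simp
    ring)
  rwa [mul_one] at h

theorem exists_isTheta (hp : 2 < p) {d : ℤ} (hd : (d : ZMod p) ≠ 0) (s : ZMod p) :
    ∃ θ : Equiv.Perm (Gp p), IsTheta p d s θ ∧ ∀ g, θ g =
      thetaFun (d : ZMod (p ^ 2)) s.val ((d : ZMod p)⁻¹ + s - 1).val g := by
  obtain ⟨E, hE⟩ := isUnit_of_redP (z := (d : ZMod (p ^ 2))) (by rwa [map_intCast])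
  have hinj := thetaFun_injective (s.val : ZMod (p ^ 2))
    (((d : ZMod p)⁻¹ + s - 1).val : ZMod (p ^ 2)) hE
  refine ⟨Equiv.ofBijective _ (Finite.injective_iff_bijective.mp hinj),
    (isTheta_iff hp d s _).mpr ⟨?_, ?_, ?_⟩, fun g => rfl⟩
  · exact thetaFun_mul hp (natCast_mul_lift hd s)
  · apply coord_ext <;> simp [thetaFun]
  · rw [y_zpow]
    apply coord_ext <;> simp [thetaFun]

theorem _root_.IsTheta.eq (hp : 2 < p) {d : ℤ} {s : ZMod p} {θ θ' : Equiv.Perm (Gp p)}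
    (h : IsTheta p d s θ) (h' : IsTheta p d s θ') : θ = θ' := by
  rw [isTheta_iff hp] at h h'
  exact h.1.ext h'.1 (h.2.1.trans h'.2.1.symm) (h.2.2.trans h'.2.2.symm)

theorem _root_.IsTheta.op_mem_NHol (hp : 2 < p) {d : ℤ} {s : ZMod p} {θ : Equiv.Perm (Gp p)}
    (h : IsTheta p d s θ) : op θ ∈ NHol (Gp p) := by
  rw [isTheta_iff hp] at h
  exact h.1.op_mem_NHol (gammaST_isEquivariant hp _ _)

theorem _root_.IsTheta.mul_isTwist (hp : 2 < p) {d e : ℤ} (he : (e : ZMod p) ≠ 0) {s u : ZMod p}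
    {θ θ' : Equiv.Perm (Gp p)} (h : IsTheta p d s θ) (h' : IsTheta p e u θ') :
    IsTwist (gammaST (s * (e : ZMod p)⁻¹ + u)
      (((d * e : ℤ) : ZMod p)⁻¹ + (s * (e : ZMod p)⁻¹ + u) - 1)) (θ' * θ) := by
  have h1 := ((isTheta_iff hp _ _ _).mp h).1
  have h2 := ((isTheta_iff hp _ _ _).mp h').1
  obtain ⟨θ'', h3, hθ''⟩ := exists_isTheta hp he u
  obtain rfl := h'.eq hp h3
  intro g k
  rw [Equiv.Perm.mul_apply, h1 g k, circ, h2, circ, circ]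
  refine congrArg (· * _) ?_
  simp only [Equiv.Perm.mul_apply]
  generalize θ g = a
  generalize θ k = b
  have hpp := natCast_mul_self_eq_zero (p := p)
  obtain ⟨E', hE⟩ := isUnit_of_redP (z := (e : ZMod (p ^ 2))) (by rwa [map_intCast])
  have hE' : redP p E' = (e : ZMod p)⁻¹ := by
    have := congrArg (redP p) hE
    rw [map_mul, map_intCast, map_one] at this
    exact eq_inv_of_mul_eq_one_right this
  have hS : (p : ZMod (p ^ 2)) * ((s * (e : ZMod p)⁻¹ + u).val : ZMod (p ^ 2)) =
      p * ((s.val : ZMod (p ^ 2)) * E' + (u.val : ZMod (p ^ 2))) := by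
    rw [natCast_mul_eq_iff]
    simp only [map_add, map_mul, redP_natCast_val, hE']
  have hT : (p : ZMod (p ^ 2)) * ((((d * e : ℤ) : ZMod p)⁻¹ +
      (s * (e : ZMod p)⁻¹ + u) - 1).val : ZMod (p ^ 2)) =
      p * ((((d : ZMod p)⁻¹ + s - 1).val : ZMod (p ^ 2)) * E' +
        (((e : ZMod p)⁻¹ + u - 1).val : ZMod (p ^ 2))) := by
    rw [natCast_mul_eq_iff]
    simp only [map_add, map_mul, redP_natCast_val, hE', Int.cast_mul, mul_inv]
    ring
  apply coord_ext
  · rw [ci_gammaST, ci_gammaST, hθ'', hθ'', hθ'']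
    simp only [thetaFun, ci_mk, cj_mk, ci_gammaST, cj_gammaST]
    generalize (s.val : ZMod (p ^ 2)) = S at *
    grind
  · rw [cj_gammaST, cj_gammaST, hθ'', hθ'', hθ'']
    simp only [thetaFun, cj_mk, ci_gammaST, cj_gammaST]
    grind

theorem exists_mk_eq_isTheta (hp : 2 < p) (q : T (Gp p)) :
    ∃ (a : (ZMod p)ˣ) (s : ZMod p), ∀ (d : ℤ) (θ : Equiv.Perm (Gp p)) (hθ : op θ ∈ NHol (Gp p)),
      (d : ZMod p) = a → IsTheta p d s θ →
        QuotientGroup.mk (⟨op θ, hθ⟩ : NHol (Gp p)) = q := by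
  obtain ⟨θ, hθ, h1, rfl⟩ := exists_mk_eq_of_map_one q
  obtain ⟨γ, hγ, hθγ⟩ := exists_isTwist_of_op_mem_NHol hθ h1
  obtain ⟨s, t, rfl⟩ := exists_eq_gammaST hp hγ
  -- If it vanished, ∘ would be commutative, and `θ` would make G_p abelian.
  have hne : t - s + 1 ≠ 0 := by
    intro h0
    have hpp := natCast_mul_self_eq_zero (p := p)
    have h2 : (p : ZMod (p ^ 2)) * ((t.val : ZMod (p ^ 2)) - (s.val : ZMod (p ^ 2)) + 1) = 0 := by
      rw [natCast_mul_eq_zero_iff, map_add, map_sub, redP_natCast_val, redP_natCast_val, map_one,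
        h0]
    have h3 : Gp.x p * Gp.y p = Gp.y p * Gp.x p := by
      apply θ.injective
      rw [hθγ, hθγ]
      generalize θ (Gp.x p) = a
      generalize θ (Gp.y p) = b
      apply coord_ext
      · simp only [circ, ci_mul, ci_gammaST, cj_gammaST]
        grind
      · simp only [circ, cj_mul, cj_gammaST]
        ring
    have h4 := congrArg ci h3
    simp only [ci_mul, ci_x, ci_y, cj_x, cj_y, mul_zero, add_zero, zero_add, mul_one] at h4
    exact natCast_ne_zero (p := p) (by linear_combination h4)
  refine ⟨(Units.mk0 _ hne)⁻¹, s, fun d θ' hθ' hd h' => ?_⟩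
  rw [((isTheta_iff hp _ _ _).mp h').1.mk_eq_mk_iff hθγ, hd, Units.val_inv_eq_inv_val, inv_inv,
    Units.val_mk0]
  congr 1
  ring

end Gp

end Theta

/-! ### Group structure of T(G_p) -/

section Structure

variable {p : ℕ} [Fact p.Prime]

namespace Gp

theorem intCast_val_ne_zero (a : (ZMod p)ˣ) : ((((a : ZMod p).val : ℤ)) : ZMod p) ≠ 0 := by
  simp

/-- The map `θ_{d,s}`, for `d` the least positive representative of a unit modulo `p`. -/
noncomputable def theta (hp : 2 < p) (a : (ZMod p)ˣ) (s : ZMod p) : Equiv.Perm (Gp p) :=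
  (exists_isTheta hp (intCast_val_ne_zero a) s).choose

theorem isTheta_theta (hp : 2 < p) (a : (ZMod p)ˣ) (s : ZMod p) :
    IsTheta p ((a : ZMod p).val : ℤ) s (theta hp a s) :=
  (exists_isTheta hp (intCast_val_ne_zero a) s).choose_spec.1

theorem theta_isTwist (hp : 2 < p) (a : (ZMod p)ˣ) (s : ZMod p) :
    IsTwist (gammaST s ((a : ZMod p)⁻¹ + s - 1)) (theta hp a s) := by
  have h := ((isTheta_iff hp _ _ _).mp (isTheta_theta hp a s)).1
  simpa [-ZMod.inv_coe_unit] using h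

/-- The class of `θ_{d,s}` in `T(G_p)`. -/
noncomputable def thetaClass (hp : 2 < p) (a : (ZMod p)ˣ) (s : ZMod p) : T (Gp p) :=
  QuotientGroup.mk (⟨op (theta hp a s), (isTheta_theta hp a s).op_mem_NHol hp⟩ : NHol (Gp p))

theorem thetaClass_eq (hp : 2 < p) {d : ℤ} {a : (ZMod p)ˣ} (hd : (d : ZMod p) = a) (s : ZMod p)
    (θ : Equiv.Perm (Gp p)) (hθ : op θ ∈ NHol (Gp p)) (h : IsTheta p d s θ) :
    thetaClass hp a s = QuotientGroup.mk (⟨op θ, hθ⟩ : NHol (Gp p)) := by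
  have h' := ((isTheta_iff hp _ _ _).mp h).1
  rw [hd] at h'
  exact ((theta_isTwist hp a s).mk_eq_mk_iff h' _ hθ).mpr rfl

theorem thetaClass_mul (hp : 2 < p) (d e : (ZMod p)ˣ) (s u : ZMod p) :
    thetaClass hp d s * thetaClass hp e u =
      thetaClass hp (d * e) (s * (e⁻¹ : (ZMod p)ˣ) + u) := by
  have h := (isTheta_theta hp d s).mul_isTwist hp (intCast_val_ne_zero e) (isTheta_theta hp e u)
  have hn : op (theta hp e u * theta hp d s) ∈ NHol (Gp p) :=
    h.op_mem_NHol (gammaST_isEquivariant hp _ _)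
  refine (h.mk_eq_mk_iff (theta_isTwist hp _ _) hn _).mpr ?_
  simp [-ZMod.inv_coe_unit]

theorem thetaClass_bijective (hp : 2 < p) :
    Function.Bijective fun q : (ZMod p)ˣ × ZMod p => thetaClass hp q.1 q.2 := by
  constructor
  · rintro ⟨a, s⟩ ⟨b, u⟩ h
    have h1 := ((theta_isTwist hp a s).mk_eq_mk_iff (theta_isTwist hp b u) _ _).mp h
    obtain ⟨rfl, h2⟩ := gammaST_inj h1
    have h3 : (a : ZMod p)⁻¹ = (b : ZMod p)⁻¹ := by linear_combination h2
    rw [Units.ext (inv_injective h3)]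
  · intro q
    obtain ⟨a, s, h⟩ := exists_mk_eq_isTheta hp q
    exact ⟨(a, s), h _ _ _ (by simp) (isTheta_theta hp a s)⟩

/-- The parametrization of `T(G_p)` by the pairs `(d, s)`. -/
noncomputable def paramEquiv (hp : 2 < p) : (ZMod p)ˣ × ZMod p ≃ T (Gp p) :=
  Equiv.ofBijective _ (thetaClass_bijective hp)

theorem paramEquiv_mul (hp : 2 < p) (q r : (ZMod p)ˣ × ZMod p) :
    paramEquiv hp q * paramEquiv hp r =
      paramEquiv hp (q.1 * r.1, q.2 * (r.1⁻¹ : (ZMod p)ˣ) + r.2) :=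
  thetaClass_mul hp _ _ _ _

/-- A bijection from the pairs `(d, s)` with the multiplication of `T(G_p)` yields an
isomorphism. -/
theorem nonempty_mulEquiv (hp : 2 < p) {H : Type*} [Mul H] (f : (ZMod p)ˣ × ZMod p → H)
    (hf : Function.Bijective f)
    (hmul : ∀ q r, f (q.1 * r.1, q.2 * (r.1⁻¹ : (ZMod p)ˣ) + r.2) = f q * f r) :
    Nonempty (T (Gp p) ≃* H) := by
  refine ⟨MulEquiv.mk' ((paramEquiv hp).symm.trans (Equiv.ofBijective f hf)) fun a b => ?_⟩
  obtain ⟨q, rfl⟩ := (paramEquiv hp).surjective a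
  obtain ⟨r, rfl⟩ := (paramEquiv hp).surjective b
  rw [paramEquiv_mul]
  simpa [-ZMod.inv_coe_unit] using hmul q r

theorem natCard_T (hp : 2 < p) : Nat.card (T (Gp p)) = p * (p - 1) := by
  rw [← Nat.card_congr (paramEquiv hp), Nat.card_prod, Nat.card_zmod, Nat.card_eq_fintype_card,
    ZMod.card_units, mul_comm]

/-- The affine map `w ↦ d (w - s)`. -/
def affineOfPair (q : (ZMod p)ˣ × ZMod p) : ZMod p ≃ᵃ[ZMod p] ZMod p where
  toFun w := q.1 * (w - q.2)
  invFun w := (q.1⁻¹ : (ZMod p)ˣ) * w + q.2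
  left_inv w := by simp [-ZMod.inv_coe_unit]
  right_inv w := by simp [-ZMod.inv_coe_unit]
  linear := LinearEquiv.smulOfUnit q.1
  map_vadd' v w := by
    change (q.1 : ZMod p) * (w + v - q.2) = (q.1 : ZMod p) * w + q.1 * (v - q.2)
    ring

theorem affineOfPair_apply (q : (ZMod p)ˣ × ZMod p) (w : ZMod p) :
    affineOfPair q w = q.1 * (w - q.2) := rfl

theorem affineOfPair_bijective : Function.Bijective (affineOfPair (p := p)) := by
  constructor
  · rintro ⟨a, s⟩ ⟨b, u⟩ h
    have h1 := congrArg (fun f : ZMod p ≃ᵃ[ZMod p] ZMod p => f s) h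
    have h2 := congrArg (fun f : ZMod p ≃ᵃ[ZMod p] ZMod p => f (s + 1)) h
    simp only [affineOfPair_apply] at h1 h2
    have h3 : a = b := Units.ext (by linear_combination h2 - h1)
    subst h3
    have h4 : (a : ZMod p) * (s - u) = 0 := by linear_combination -h1
    rw [Units.mul_right_eq_zero, sub_eq_zero] at h4
    rw [h4]
  · intro f
    have hne : f.linear 1 ≠ 0 := by simp
    have hf : ∀ w, f w = w * f.linear 1 + f 0 := by
      intro w
      have h1 := f.map_vadd 0 w
      have h2 := f.linear.map_smul w 1
      simp only [vadd_eq_add, smul_eq_mul, mul_one, add_zero] at h1 h2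
      rw [h1, h2]
    refine ⟨(Units.mk0 _ hne, -(f.linear 1)⁻¹ * f 0), ?_⟩
    ext w
    rw [affineOfPair_apply, hf w, Units.val_mk0]
    field_simp
    ring

/-- Affine equivalences compose right to left and `SymLR` left to right, so the map attached to (d,
s) here is the inverse of v ↦ vd⁻¹ + s, used for the holomorph. -/
theorem nonempty_mulEquiv_affine (hp : 2 < p) :
    Nonempty (T (Gp p) ≃* (ZMod p ≃ᵃ[ZMod p] ZMod p)) := by
  refine nonempty_mulEquiv hp affineOfPair affineOfPair_bijective fun q r => ?_
  ext w
  rw [AffineEquiv.mul_def, AffineEquiv.trans_apply, affineOfPair_apply, affineOfPair_apply,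
    affineOfPair_apply]
  rw [Units.val_mul]
  linear_combination (-(q.1 : ZMod p) * q.2) * r.1.mul_inv

/-- The permutation `v ↦ v d⁻¹ + s` of the additive group of `F_p`. -/
def permOfPair (q : (ZMod p)ˣ × ZMod p) : Equiv.Perm (Multiplicative (ZMod p)) where
  toFun w := Multiplicative.ofAdd (w.toAdd * (q.1⁻¹ : (ZMod p)ˣ) + q.2)
  invFun w := Multiplicative.ofAdd ((w.toAdd - q.2) * q.1)
  left_inv w := by simp [-ZMod.inv_coe_unit]
  right_inv w := by simp [-ZMod.inv_coe_unit]

theorem toAdd_permOfPair (q : (ZMod p)ˣ × ZMod p) (w : Multiplicative (ZMod p)) :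
    (permOfPair q w).toAdd = w.toAdd * (q.1⁻¹ : (ZMod p)ˣ) + q.2 := rfl

theorem op_permOfPair_mem_Hol (q : (ZMod p)ˣ × ZMod p) :
    op (permOfPair q) ∈ Hol (Multiplicative (ZMod p)) := by
  rw [op_mem_Hol_iff]
  intro g h
  apply Multiplicative.toAdd.injective
  simp only [toAdd_mul, toAdd_inv, toAdd_permOfPair, toAdd_one]
  ring

theorem permOfPair_bijective : Function.Bijective fun q : (ZMod p)ˣ × ZMod p =>
    (⟨op (permOfPair q), op_permOfPair_mem_Hol q⟩ : Hol (Multiplicative (ZMod p))) := by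
  constructor
  · rintro ⟨a, s⟩ ⟨b, u⟩ h
    have h0 : permOfPair (a, s) = permOfPair (b, u) := op_injective (congrArg Subtype.val h)
    have h1 := congrArg (fun f => (f (Multiplicative.ofAdd (0 : ZMod p))).toAdd) h0
    have h2 := congrArg (fun f => (f (Multiplicative.ofAdd (1 : ZMod p))).toAdd) h0
    simp only [toAdd_permOfPair, toAdd_ofAdd, zero_mul, zero_add, one_mul] at h1 h2
    subst h1
    rw [add_left_inj, Units.val_inj, inv_inj] at h2
    rw [h2]
  · rintro ⟨f, hf⟩
    obtain ⟨σ, rfl⟩ := op_surjective f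
    rw [op_mem_Hol_iff] at hf
    let τ : ZMod p → ZMod p := fun v => (σ (Multiplicative.ofAdd v)).toAdd
    have hτ : ∀ v w, τ (v + w) = τ v - τ 0 + τ w := fun v w => by
      have := congrArg Multiplicative.toAdd (hf (Multiplicative.ofAdd v) (Multiplicative.ofAdd w))
      rwa [toAdd_mul, toAdd_mul, toAdd_inv, ← sub_eq_add_neg] at this
    -- The holomorph identity makes `τ` affine, because 1 generates the additive group of F_p.
    have hn : ∀ n : ℕ, τ n = n * (τ 1 - τ 0) + τ 0 := by
      intro n
      induction n with
      | zero => simp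
      | succ n ih => rw [Nat.cast_succ, hτ, ih]; ring
    have hne : τ 1 - τ 0 ≠ 0 := by
      intro h
      have h2 : Multiplicative.ofAdd (1 : ZMod p) = Multiplicative.ofAdd 0 :=
        σ.injective (Multiplicative.toAdd.injective (sub_eq_zero.mp h))
      exact one_ne_zero (Multiplicative.ofAdd.injective h2)
    refine ⟨((Units.mk0 _ hne)⁻¹, τ 0), Subtype.ext (congrArg op ?_)⟩
    ext w
    apply Multiplicative.toAdd.injective
    obtain ⟨n, hn'⟩ := ZMod.natCast_zmod_surjective w.toAdd
    rw [toAdd_permOfPair, inv_inv, Units.val_mk0, ← hn', ← hn, hn']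
    rfl

theorem nonempty_mulEquiv_Hol (hp : 2 < p) :
    Nonempty (T (Gp p) ≃* Hol (Multiplicative (ZMod p))) := by
  refine nonempty_mulEquiv hp _ permOfPair_bijective fun q r => ?_
  apply Subtype.ext
  change op _ = op (permOfPair r * permOfPair q)
  refine congrArg op (Equiv.ext fun w => ?_)
  apply Multiplicative.toAdd.injective
  rw [Equiv.Perm.mul_apply, toAdd_permOfPair, toAdd_permOfPair, toAdd_permOfPair]
  simp only [mul_inv, Units.val_mul]
  ring

theorem T_not_comm (hp : 2 < p) : ∃ σ τ : T (Gp p), σ * τ ≠ τ * σ := by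
  -- The two products are (-1, -1) and (-1, 1).
  refine ⟨paramEquiv hp (1, 1), paramEquiv hp (-1, 0), fun h => ?_⟩
  rw [paramEquiv_mul, paramEquiv_mul, (paramEquiv hp).injective.eq_iff, Prod.mk.injEq] at h
  have : Fact (2 < p) := ⟨hp⟩
  exact ZMod.neg_one_ne_one (by simpa using h.2)

theorem T_not_isPGroup_two (hp : 2 < p) : ¬ IsPGroup 2 (T (Gp p)) := by
  intro h
  have hc := natCard_T hp
  have hpp : p.Prime := Fact.out
  have : Finite (T (Gp p)) := Finite.of_equiv _ (paramEquiv hp)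
  obtain ⟨n, hn⟩ := IsPGroup.iff_card.mp h
  have h1 : p ∣ 2 ^ n := ⟨p - 1, by rw [← hn, hc]⟩
  exact hp.ne' ((Nat.prime_dvd_prime_iff_eq hpp Nat.prime_two).mp (hpp.dvd_of_dvd_pow h1))

/-- The homomorphism sending the class of `θ_{d,s}` to `d`. -/
noncomputable def multiplier (hp : 2 < p) : T (Gp p) →* (ZMod p)ˣ :=
  MonoidHom.mk' (fun q => ((paramEquiv hp).symm q).1) fun a b => by
    obtain ⟨q, rfl⟩ := (paramEquiv hp).surjective a
    obtain ⟨r, rfl⟩ := (paramEquiv hp).surjective b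
    rw [paramEquiv_mul, Equiv.symm_apply_apply, Equiv.symm_apply_apply, Equiv.symm_apply_apply]

theorem closure_involutions_ne_top (hp : 3 < p) :
    Subgroup.closure {τ : T (Gp p) | orderOf τ = 2} ≠ ⊤ := by
  have hp2 : 2 < p := by omega
  intro h
  -- Involutions have multiplier d with d² = 1, whereas d = 2 would need p to divide 3.
  have hle : Subgroup.closure {τ : T (Gp p) | orderOf τ = 2} ≤
      ((powMonoidHom 2).comp (multiplier hp2)).ker := by
    rw [Subgroup.closure_le]
    intro τ hτ
    change multiplier hp2 τ ^ 2 = 1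
    rw [← map_pow, orderOf_dvd_iff_pow_eq_one.mp hτ.dvd, map_one]
  have hne : (2 : ZMod p) ≠ 0 := by
    intro h0
    have : p ∣ 2 := (ZMod.natCast_eq_zero_iff 2 p).mp (by exact_mod_cast h0)
    exact absurd (Nat.le_of_dvd two_pos this) (by omega)
  have hmem : paramEquiv hp2 (Units.mk0 2 hne, 0) ∈ ((powMonoidHom 2).comp (multiplier hp2)).ker :=
    hle (h ▸ Subgroup.mem_top _)
  have h2 : Units.mk0 (2 : ZMod p) hne ^ 2 = 1 := by
    have h3 : multiplier hp2 (paramEquiv hp2 (Units.mk0 2 hne, 0)) ^ 2 = 1 := hmem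
    simpa [multiplier] using h3
  have h4 : (2 : ZMod p) ^ 2 = 1 := by simpa using congrArg Units.val h2
  have h5 : ((3 : ℕ) : ZMod p) = 0 := by
    push_cast
    linear_combination h4
  exact absurd (Nat.le_of_dvd (by norm_num) ((ZMod.natCast_eq_zero_iff 3 p).mp h5)) (by omega)

end Gp

end Structure

theorem mainTheorem2 (p : ℕ) (hp : p.Prime) (hp2 : 2 < p) :
    Nat.card (Gp p) = p ^ 4 ∧
    -- the maps `θ_{d,s}` are well defined, and lie in `NHol(G_p)`
    (∀ d : ℤ, IsCoprime d (p : ℤ) → ∀ s : ZMod p,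
      (∃! θ : Equiv.Perm (Gp p), IsTheta p d s θ) ∧
      ∀ θ : Equiv.Perm (Gp p), IsTheta p d s θ → op θ ∈ NHol (Gp p)) ∧
    -- `cls d s` is the class of `θ_{d,s}` in `T(G_p)`; it depends only on `d` modulo `p`
    (∃ cls : (ZMod p)ˣ → ZMod p → T (Gp p),
      (∀ (d : ℤ) (a : (ZMod p)ˣ), (d : ZMod p) = a → ∀ (s : ZMod p) (θ : Equiv.Perm (Gp p))
        (hθ : op θ ∈ NHol (Gp p)), IsTheta p d s θ →
          cls a s = QuotientGroup.mk (⟨op θ, hθ⟩ : NHol (Gp p))) ∧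
      (∀ (d e : (ZMod p)ˣ) (s u : ZMod p),
        cls d s * cls e u = cls (d * e) (s * (e⁻¹ : (ZMod p)ˣ) + u)) ∧
      Function.Bijective (fun q : (ZMod p)ˣ × ZMod p => cls q.1 q.2)) ∧
    Nat.card (T (Gp p)) = p * (p - 1) ∧
    -- `AGL(1, p)`, and the holomorph of a group of order `p`
    Nonempty (T (Gp p) ≃* (ZMod p ≃ᵃ[ZMod p] ZMod p)) ∧
    Nonempty (T (Gp p) ≃* Hol (Multiplicative (ZMod p))) ∧
    (∃ σ τ : T (Gp p), σ * τ ≠ τ * σ) ∧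
    ¬ IsPGroup 2 (T (Gp p)) ∧
    (3 < p → Subgroup.closure {τ : T (Gp p) | orderOf τ = 2} ≠ ⊤) := by
  have : Fact p.Prime := ⟨hp⟩
  refine ⟨Gp.natCard_eq, fun d hd s => ⟨?_, fun θ hθ => hθ.op_mem_NHol hp2⟩,
    ⟨Gp.thetaClass hp2, fun d a hd s θ hθ h => Gp.thetaClass_eq hp2 hd s θ hθ h,
      Gp.thetaClass_mul hp2, Gp.thetaClass_bijective hp2⟩, Gp.natCard_T hp2,
    Gp.nonempty_mulEquiv_affine hp2, Gp.nonempty_mulEquiv_Hol hp2, Gp.T_not_comm hp2,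
    Gp.T_not_isPGroup_two hp2, Gp.closure_involutions_ne_top⟩
  have hd0 : (d : ZMod p) ≠ 0 := by
    intro h0
    rw [ZMod.intCast_zmod_eq_zero_iff_dvd] at h0
    exact (Nat.prime_iff_prime_int.mp hp).not_isUnit (hd.isUnit_of_dvd' h0 dvd_rfl)
  obtain ⟨θ, hθ, -⟩ := Gp.exists_isTheta hp2 hd0 s
  exact ⟨θ, hθ, fun θ' hθ' => hθ'.eq hp2 hθ⟩
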